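/- Let $d,k$ be natural numbers and let $\mu=(\mu_1,\dots,\mu_k)$ be a vector of Borel probability measures on $\mathbb{R}^d$. Write $B(x,r)$ for closed balls, $\operatorname{supp}\mu=\bigcap_{j}\operatorname{supp}\mu_j$ and, for $q\in\mathbb{R}^k$, $$(\mu(B(x,r)))^q=\prod_{j=1}^k\mu_j(B(x,r))^{q_j}.$$ **Definitions.** For $q\in\mathbb{R}^k$, $t\in\mathbb{R}$ and $A\subseteq\mathbb{R}^d$ let $$\overline{\mathcal P}^{q,t}_{\mu}(A)=\lim_{\varepsilon\downarrow0}\ \sup\Big\{\sum_i(\mu(B(x_i,r_i)))^q(2r_i)^t\Big\},\qquad \mathcal P^{q,t}_\mu(A)=\inf_{A\subseteq\bigcup_{i\in\mathbb N}A_i}\ \sum_i\overline{\mathcal P}^{q,t}_\mu(A_i),$$ where the supremum is over all countable families of pairwise disjoint balls $B(x_i,r_i)$ with $x_i\in A$ and $0<2r_i<\varepsilon$. Put $$B_\mu(q)=\inf\{t\in\mathbb{R}:\mathcal P^{q,t}_\mu(\operatorname{supp}\mu)=0\}\in[-\infty,+\infty].$$ Saying that $B_\mu$ is differentiable at $q$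 includes that it is finite near $q$. Let $\mathrm{Dom}(B)=\{-\nabla B_\mu(q): B_\mu\text{ is differentiable at }q\}$ and $B_\mu^*(\alpha)=\inf_{q\in\mathbb{R}^k}\big(\langle\alpha,q\rangle+B_\mu(q)\big)$. Let $$\underline\alpha_{\mu_j}(x)=\liminf_{r\downarrow0}\frac{\log\mu_j(B(x,r))}{\log r},\qquad \overline\alpha_{\mu_j}(x)=\limsup_{r\downarrow0}\frac{\log\mu_j(B(x,r))}{\log r}.$$ The local dimension $\alpha_\mu(x)$ exists and equals $\alpha\in\mathbb{R}^k$ if $\underline\alpha_{\mu_j}(x)=\overline\alpha_{\mu_j}(x)=\alpha_j$ for all $j$; $\alpha_\mu(\operatorname{supp}\mu)$ is the set of the values $\alpha_\mu(x)$ over those $x\in\operatorname{supp}\mu$ at which it exists. Finally, with $\dim$ the Hausdorff dimension, $$f_\mu(\alpha)=\dim\{x\in\operatorname{supp}\mu:\ \alpha_j\le\underline\alpha_{\mu_j}(x)\ \text{and}\ \overline\alpha_{\mu_j}(x)\le\alpha_j\ \text{for all } j\}.$$ **Hypotheses.** Suppose that for every $q\in\mathbb{R}^k$ there are given $t_q\in\mathbb{R}$,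 $r_q,\underline K_q,\overline K_q>0$, a Borel probability measure $\nu_q$ with $\nu_q(\mathbb{R}^d\setminus\operatorname{supp}\mu)=0$, a real function $\varphi_q$ with $\varphi_q(r)=o(\log r)$ as $r\downarrow0$, and a nonincreasing sequence $(r_{q,n})_n$ in $(0,1)$ with $r_{q,n}\to0$, $\log r_{q,n+1}/\log r_{q,n}\to1$ and $\sum_nr_{q,n}^\varepsilon<\infty$ for all $\varepsilon>0$, such that * for all $x\in\operatorname{supp}\mu$ and $r\in(0,r_q)$, $$\underline K_q\le\frac{\nu_q(B(x,r))}{(\mu(B(x,r)))^q(2r)^{t_q}\exp(\varphi_q(r))}\le\overline K_q;$$ * for every $p\in\mathbb{R}^k$ the following limit exists and is finite: $$C_q(p)=\lim_{n\to\infty}\frac{1}{-\log r_{q,n}}\log\int_{\operatorname{supp}\mu}(\mu(B(x,r_{q,n})))^p\,d\nu_q(x).$$ **Conclusions.** 1. If $B_\mu$ is differentiable at $q$, then $\alpha_\mu(x)$ exists and equals $-\nabla B_\mu(q)$ for $\nu_q$-almost every $x$. 2. $\mathrm{Dom}(B)\subseteq\alpha_\mu(\operatorname{supp}\mu)$, and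 $f_\mu(\alpha)=B_\mu^*(\alpha)$ for every $\alpha\in\mathrm{Dom}(B)$. -/

import Mathlib

open MeasureTheory Set Filter Topology
open scoped ENNReal

namespace MixedMultifractal

noncomputable section

variable {d k : ℕ}

/-- The ambient Euclidean space `ℝⁿ`. -/
abbrev E (n : ℕ) : Type := EuclideanSpace ℝ (Fin n)

/-- The support of the vector valued measure `μ = (μ₁, …, μₖ)`: the points all of whose
neighbourhoods are charged by every `μⱼ`. -/
def supp (μ : Fin k → Measure (E d)) : Set (E d) := ⋂ j, (μ j).support

/-- `(μ(B(x,r)))^q = μ₁(B(x,r))^{q₁} ⋯ μₖ(B(x,r))^{qₖ}`, with closed balls. -/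
def ballPow (μ : Fin k → Measure (E d)) (q : E k) (x : E d) (r : ℝ) : ℝ≥0∞ :=
  ∏ j, (μ j (Metric.closedBall x r)) ^ (q j)

/-- A centered `ε`-packing of `A`: a countable family of pairwise disjoint closed balls of
diameter less than `ε` centered at points of `A`, given by its pairs (center, radius). -/
structure IsCenteredPacking (A : Set (E d)) (ε : ℝ) (S : Set (E d × ℝ)) : Prop where
  countable : S.Countable
  center_mem : ∀ p ∈ S, p.1 ∈ A
  radius_pos : ∀ p ∈ S, 0 < p.2
  diam_lt : ∀ p ∈ S, 2 * p.2 < ε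
  disjoint : S.PairwiseDisjoint fun p => Metric.closedBall p.1 p.2

/-- `sup ∑ᵢ (μ(B(xᵢ,rᵢ)))^q (2rᵢ)^t` over the centered `ε`-packings of `A`. -/
def packingPreAt (μ : Fin k → Measure (E d)) (q : E k) (t ε : ℝ) (A : Set (E d)) : ℝ≥0∞ :=
  ⨆ (S : Set (E d × ℝ)) (_ : IsCenteredPacking A ε S),
    ∑' p : S, ballPow μ q p.1.1 p.1.2 * ENNReal.ofReal ((2 * p.1.2) ^ t)

/-- The packing pre-measure: the limit of `packingPreAt` as `ε ↓ 0`, which is an infimum. -/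
def packingPre (μ : Fin k → Measure (E d)) (q : E k) (t : ℝ) (A : Set (E d)) : ℝ≥0∞ :=
  ⨅ (ε : ℝ) (_ : 0 < ε), packingPreAt μ q t ε A

/-- The mixed generalized multifractal packing measure `𝒫_μ^{q,t}`. -/
def packingMeasure (μ : Fin k → Measure (E d)) (q : E k) (t : ℝ) (A : Set (E d)) : ℝ≥0∞ :=
  ⨅ (F : ℕ → Set (E d)) (_ : A ⊆ ⋃ i, F i), ∑' i, packingPre μ q t (F i)

/-- `Dim_μ^q(A) = inf {t ∈ ℝ : 𝒫_μ^{q,t}(A) = 0}`, an extended real number. -/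
def packingDim (μ : Fin k → Measure (E d)) (q : E k) (A : Set (E d)) : EReal :=
  ⨅ (t : ℝ) (_ : packingMeasure μ q t A = 0), (t : EReal)

/-- The function `B_μ(q) = Dim_μ^q(supp μ)`. -/
def B (μ : Fin k → Measure (E d)) (q : E k) : EReal := packingDim μ q (supp μ)

/-- An extended real valued function is differentiable at `q` with gradient `v`: it is finite
near `q` and the real function that it defines there has gradient `v` at `q`. -/
def HasGrad (F : E k → EReal) (v q : E k) : Prop :=
  (∀ᶠ p in 𝓝 q, F p ≠ ⊥ ∧ F p ≠ ⊤) ∧ HasGradientAt (fun p => (F p).toReal) v q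

/-- `Dom(F)`, the set of the `-∇F(q)` over the points `q` at which `F` is differentiable. -/
def negGradients (F : E k → EReal) : Set (E k) := {a | ∃ q v, HasGrad F v q ∧ a = -v}

/-- The Legendre transform `F*(a) = inf_q (⟨a,q⟩ + F(q))`. -/
def legendre (F : E k → EReal) (a : E k) : EReal :=
  ⨅ q : E k, ((inner ℝ a q : ℝ) : EReal) + F q

/-- The lower local dimension of `m` at `x`. -/
def lowerLocalDim (m : Measure (E d)) (x : E d) : EReal :=
  liminf (fun r : ℝ => ENNReal.log (m (Metric.closedBall x r)) / (Real.log r : EReal)) (𝓝[>] 0)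

/-- The upper local dimension of `m` at `x`. -/
def upperLocalDim (m : Measure (E d)) (x : E d) : EReal :=
  limsup (fun r : ℝ => ENNReal.log (m (Metric.closedBall x r)) / (Real.log r : EReal)) (𝓝[>] 0)

/-- The mixed local dimension `α_μ(x)` exists and is the vector `a`. -/
def HasLocalDim (μ : Fin k → Measure (E d)) (x : E d) (a : E k) : Prop :=
  ∀ j, lowerLocalDim (μ j) x = (a j : EReal) ∧ upperLocalDim (μ j) x = (a j : EReal)

/-- `α_μ(A)`, the set of the values `α_μ(x)` over the points `x ∈ A` at which it exists. -/
def localDimImage (μ : Fin k → Measure (E d)) (A : Set (E d)) : Set (E k) :=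
  {a | ∃ x ∈ A, HasLocalDim μ x a}

/-- The points of the support at which every lower local dimension is at least `aⱼ`. -/
def lowerSet (μ : Fin k → Measure (E d)) (a : E k) : Set (E d) :=
  {x ∈ supp μ | ∀ j, (a j : EReal) ≤ lowerLocalDim (μ j) x}

/-- The points of the support at which every upper local dimension is at most `aⱼ`. -/
def upperSet (μ : Fin k → Measure (E d)) (a : E k) : Set (E d) :=
  {x ∈ supp μ | ∀ j, upperLocalDim (μ j) x ≤ (a j : EReal)}

/-- The mixed multifractal spectrum: `f_μ(a)` is the Hausdorff dimension of `X(a)`. -/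
def spectrum (μ : Fin k → Measure (E d)) (a : E k) : ℝ≥0∞ :=
  dimH (lowerSet μ a ∩ upperSet μ a)

/-- `C_n(p) = (1 / (-log rₙ)) log ∫_{supp μ} (μ(B(x,rₙ)))^p dν(x)`, at the radius `rₙ = r`. -/
def logMoment (μ : Fin k → Measure (E d)) (ν : Measure (E d)) (r : ℝ) (p : E k) : EReal :=
  ENNReal.log (∫⁻ x in supp μ, ballPow μ p x r ∂ν) / ((-Real.log r : ℝ) : EReal)

/-- The hypotheses at a fixed `q` on the number `t`, the radius `r₀`, the constants `K₁`, `K₂`,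
the measure `ν`, the function `φ` and the sequence of radii `ρ`. -/
structure GibbsHypotheses (μ : Fin k → Measure (E d)) (q : E k) (t r₀ K₁ K₂ : ℝ)
    (ν : Measure (E d)) (φ : ℝ → ℝ) (ρ : ℕ → ℝ) : Prop where
  r₀_pos : 0 < r₀
  K₁_pos : 0 < K₁
  K₂_pos : 0 < K₂
  prob : IsProbabilityMeasure ν
  supported : ν (supp μ)ᶜ = 0
  phi_isLittleO : φ =o[𝓝[>] 0] Real.log
  rho_mem : ∀ n, ρ n ∈ Ioo (0 : ℝ) 1
  rho_anti : Antitone ρ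
  rho_tendsto : Tendsto ρ atTop (𝓝 0)
  rho_log_ratio : Tendsto (fun n => Real.log (ρ (n + 1)) / Real.log (ρ n)) atTop (𝓝 1)
  rho_summable : ∀ ε : ℝ, 0 < ε → Summable fun n => ρ n ^ ε
  gibbs : ∀ x ∈ supp μ, ∀ r ∈ Ioo (0 : ℝ) r₀,
    ENNReal.ofReal K₁ ≤ ν (Metric.closedBall x r) /
        (ballPow μ q x r * ENNReal.ofReal ((2 * r) ^ t * Real.exp (φ r))) ∧
      ν (Metric.closedBall x r) /
        (ballPow μ q x r * ENNReal.ofReal ((2 * r) ^ t * Real.exp (φ r))) ≤ ENNReal.ofReal K₂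
  moment_limit : ∀ p : E k, ∃ c : ℝ,
    Tendsto (fun n => logMoment μ ν (ρ n) p) atTop (𝓝 (c : EReal))

end

end MixedMultifractal

/-!
On the support, the Gibbs condition says that `ν_q(B(x,r)) = (μ(B(x,r)))^q (2r)^{t_q + o(1)}`
uniformly in `x` (`IsGibbs`). Everything follows from comparing such measures on disjoint balls.

*The exponent is `B_μ`.* For `s > t_q` a packing sum with exponents `(q, s)` is at most a positive
power of the scale times the total mass of `ν_q`, so the packing pre-measure of the support vanishes
(`IsGibbs.packingPre_supp_eq_zero`). Conversely, by the Besicovitch-Vitali covering theorem a finite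
measure that is dominated by `(μ(B(x,r)))^q (2r)^s` at arbitrarily small scales is dominated by the
packing pre-measure (`measure_le_packingPre`); for `s < t_q` this applies to `ν_q`, and the packing
measure of the support is at least `1`. Hence `B_μ(q) = t_q` (`IsGibbs.B_eq`).

*Local dimensions.* At the points where `(μ(B(x,r)))^p ≥ (2r)^{-c}` for arbitrarily small `r`, the
measure `ν_q` is dominated along these radii by `(μ(B(x,r)))^{q+p} (2r)^{t_q+c}`, up to `o(1)` in the
exponent. If `t_q + c > t_{q+p}`, the packing pre-measure with these exponents vanishes because of
`ν_{q+p}`, so that the set of these points is `ν_q`-null (`IsGibbs.ae_eventually_logBallPow_lt`).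
Taking `p = ±s eⱼ` with `s` small, differentiability of `q ↦ t_q` gives both bounds on the `j`-th
local dimension, over all radii at once.

*The spectrum.* Where `μ` has local dimension `α`, the measure `ν_p` has local dimension
`⟨α, p⟩ + t_p` for every `p`. The two halves of Billingsley's lemma
(`dimH_le_of_frequently_le_measure`, `le_dimH_of_eventually_measure_le`) bound the dimension of the
level set by `⟨α, p⟩ + t_p` from above for every `p`, and from below for `p = q` with `α = -∇B_μ(q)`,
since then the level set has full `ν_q`-measure.
-/

namespace MixedMultifractal

variable {d k : ℕ}

/-! ### Measures of balls on a logarithmic scale -/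

/-- The logarithm `∑ⱼ qⱼ log μⱼ(B(x,r))` of `(μ(B(x,r)))^q`, as a real number; it is meaningful
when every `μⱼ` is finite and charges the ball. -/
noncomputable def logBallPow (μ : Fin k → Measure (E d)) (q : E k) (x : E d) (r : ℝ) : ℝ :=
  ∑ j, q j * Real.log ((μ j).real (Metric.closedBall x r))

theorem logBallPow_add (μ : Fin k → Measure (E d)) (p q : E k) (x : E d) (r : ℝ) :
    logBallPow μ (p + q) x r = logBallPow μ p x r + logBallPow μ q x r := by
  simp [logBallPow, add_mul, Finset.sum_add_distrib]

theorem logBallPow_single (μ : Fin k → Measure (E d)) (j : Fin k) (s : ℝ) (x : E d) (r : ℝ) :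
    logBallPow μ (EuclideanSpace.single j s) x r =
      s * Real.log ((μ j).real (Metric.closedBall x r)) := by
  simp [logBallPow, PiLp.single_apply, ite_mul]

theorem measureReal_closedBall_pos {μ : Fin k → Measure (E d)} (hμ : ∀ j, IsFiniteMeasure (μ j))
    {x : E d} (hx : x ∈ supp μ) {r : ℝ} (hr : 0 < r) (j : Fin k) :
    0 < (μ j).real (Metric.closedBall x r) := by
  have := hμ j
  have h := (Measure.mem_support_iff_forall x).1 (mem_iInter.1 hx j) _
    (Metric.closedBall_mem_nhds x hr)
  exact ENNReal.toReal_pos h.ne' (measure_ne_top _ _)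

theorem ballPow_eq_ofReal_exp {μ : Fin k → Measure (E d)} (hμ : ∀ j, IsFiniteMeasure (μ j))
    (q : E k) {x : E d} (hx : x ∈ supp μ) {r : ℝ} (hr : 0 < r) :
    ballPow μ q x r = ENNReal.ofReal (Real.exp (logBallPow μ q x r)) := by
  rw [ballPow, logBallPow, Real.exp_sum, ENNReal.ofReal_prod_of_nonneg fun _ _ => (Real.exp_pos _).le]
  refine Finset.prod_congr rfl fun j _ => ?_
  have := hμ j
  have h := measureReal_closedBall_pos hμ hx hr j
  rw [← ofReal_measureReal (μ := μ j) (s := Metric.closedBall x r), ENNReal.ofReal_rpow_of_pos h,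
    Real.rpow_def_of_pos h, mul_comm]

theorem ballPow_mul_rpow {μ : Fin k → Measure (E d)} (hμ : ∀ j, IsFiniteMeasure (μ j))
    (q : E k) (t : ℝ) {x : E d} (hx : x ∈ supp μ) {r : ℝ} (hr : 0 < r) :
    ballPow μ q x r * ENNReal.ofReal ((2 * r) ^ t) =
      ENNReal.ofReal (Real.exp (logBallPow μ q x r + t * Real.log (2 * r))) := by
  rw [ballPow_eq_ofReal_exp hμ q hx hr, ← ENNReal.ofReal_mul (Real.exp_pos _).le, Real.exp_add,
    Real.rpow_def_of_pos (by positivity), mul_comm t]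

theorem tendsto_log_two_mul : Tendsto (fun r : ℝ => Real.log (2 * r)) (𝓝[>] 0) atBot := by
  refine Real.tendsto_log_nhdsGT_zero.comp ?_
  refine tendsto_nhdsWithin_iff.2 ⟨?_, ?_⟩
  · exact ((continuous_const_mul (2 : ℝ)).tendsto' 0 0 (by simp)).mono_left nhdsWithin_le_nhds
  · filter_upwards [self_mem_nhdsWithin] with r hr
    exact mul_pos two_pos (mem_Ioi.1 hr)

/-- The content of a Gibbs condition with exponents `(q, t)`: uniformly on the support,
`ν(B(x,r)) = (μ(B(x,r)))^q (2r)^{t + o(1)}`. -/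
def IsGibbs (μ : Fin k → Measure (E d)) (ν : Measure (E d)) (q : E k) (t : ℝ) : Prop :=
  ∀ δ : ℝ, 0 < δ → ∀ᶠ r in 𝓝[>] (0 : ℝ), ∀ x ∈ supp μ,
    0 < ν.real (Metric.closedBall x r) ∧
    |Real.log (ν.real (Metric.closedBall x r)) - (logBallPow μ q x r + t * Real.log (2 * r))| ≤
      δ * (-Real.log (2 * r))

theorem GibbsHypotheses.isGibbs {μ : Fin k → Measure (E d)} (hμ : ∀ j, IsFiniteMeasure (μ j))
    {q : E k} {t r₀ K₁ K₂ : ℝ} {ν : Measure (E d)} {φ : ℝ → ℝ} {ρ : ℕ → ℝ}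
    (h : GibbsHypotheses μ q t r₀ K₁ K₂ ν φ ρ) : IsGibbs μ ν q t := by
  intro δ hδ
  have := h.prob
  set C := |Real.log K₁| + |Real.log K₂|
  have hφ := h.phi_isLittleO.bound (half_pos hδ)
  have hlog : ∀ᶠ r in 𝓝[>] (0 : ℝ), Real.log (2 * r) ≤ -(Real.log 2 + 2 * C / δ) :=
    tendsto_log_two_mul.eventually_le_atBot _
  filter_upwards [hφ, hlog, Ioo_mem_nhdsGT h.r₀_pos, Ioo_mem_nhdsGT one_pos] with r h1 h2 hr hr1 x hx
  have hr0 : 0 < r := hr.1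
  obtain ⟨hl, hu⟩ := h.gibbs x hx r hr
  set y := ν.real (Metric.closedBall x r)
  set D := Real.exp (logBallPow μ q x r + t * Real.log (2 * r) + φ r) with hD
  have hden : ballPow μ q x r * ENNReal.ofReal ((2 * r) ^ t * Real.exp (φ r)) =
      ENNReal.ofReal D := by
    rw [ENNReal.ofReal_mul (by positivity), ← mul_assoc, ballPow_mul_rpow hμ q t hx hr0,
      ← ENNReal.ofReal_mul (Real.exp_pos _).le, ← Real.exp_add]
  have hD0 : 0 < D := Real.exp_pos _
  have hy : ν (Metric.closedBall x r) = ENNReal.ofReal y := (ofReal_measureReal).symm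
  rw [hden, hy, ← ENNReal.ofReal_div_of_pos hD0] at hl hu
  rw [ENNReal.ofReal_le_ofReal_iff h.K₂_pos.le, div_le_iff₀ hD0] at hu
  have hy0 : 0 < y := by
    by_contra hcon
    have : y / D ≤ 0 := div_nonpos_of_nonpos_of_nonneg (not_lt.1 hcon) hD0.le
    rw [ENNReal.ofReal_of_nonpos this] at hl
    have := h.K₁_pos
    simp only [nonpos_iff_eq_zero, ENNReal.ofReal_eq_zero] at hl
    linarith
  rw [ENNReal.ofReal_le_ofReal_iff (by positivity), le_div_iff₀ hD0] at hl
  have hl' := Real.log_le_log (mul_pos h.K₁_pos hD0) hl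
  have hu' := Real.log_le_log hy0 hu
  rw [Real.log_mul h.K₁_pos.ne' hD0.ne', hD, Real.log_exp] at hl'
  rw [Real.log_mul h.K₂_pos.ne' hD0.ne', hD, Real.log_exp] at hu'
  refine ⟨hy0, ?_⟩
  have hlr : Real.log (2 * r) = Real.log 2 + Real.log r := Real.log_mul two_ne_zero hr0.ne'
  rw [Real.norm_eq_abs, Real.norm_eq_abs, abs_of_neg (Real.log_neg hr0 hr1.2)] at h1
  have hC : C + δ / 2 * Real.log 2 ≤ δ / 2 * (-Real.log (2 * r)) := by
    have h3 := mul_le_mul_of_nonneg_left h2 (half_pos hδ).le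
    have h4 : δ / 2 * (2 * C / δ) = C := by field_simp
    linarith
  have hK1 := neg_abs_le (Real.log K₁)
  have hK2 := le_abs_self (Real.log K₂)
  have hK1' := abs_nonneg (Real.log K₁)
  have hK2' := abs_nonneg (Real.log K₂)
  obtain ⟨h5, h6⟩ := abs_le.1 h1
  have hCdef : C = |Real.log K₁| + |Real.log K₂| := rfl
  rw [abs_le]
  have h7 : δ / 2 * -Real.log r = δ / 2 * (-Real.log (2 * r)) + δ / 2 * Real.log 2 := by
    rw [hlr]; ring
  constructor <;> linarith

/-! ### The packing dimension function -/

/-- A finite measure that is dominated by `(μ(B(x,r)))^q (2r)^t` at arbitrarily small scales around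
each point of `A` is bounded on `A` by the packing pre-measure: by the Besicovitch-Vitali covering
theorem, disjoint balls of such radii cover almost all of `A`. -/
theorem measure_le_packingPre (μ : Fin k → Measure (E d)) (ν : Measure (E d)) [IsFiniteMeasure ν]
    (q : E k) (t : ℝ) (A : Set (E d))
    (h : ∀ x ∈ A, ∃ᶠ r in 𝓝[>] (0 : ℝ),
      ν (Metric.closedBall x r) ≤ ballPow μ q x r * ENNReal.ofReal ((2 * r) ^ t)) :
    ν A ≤ packingPre μ q t A := by
  refine le_iInf₂ fun ε hε => ?_
  obtain ⟨T, r, hT, hTA, hr, hcov, hdisj⟩ := Besicovitch.exists_disjoint_closedBall_covering_ae ν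
    (fun x => {r | ν (Metric.closedBall x r) ≤ ballPow μ q x r * ENNReal.ofReal ((2 * r) ^ t)}) A
    (fun x hx δ hδ => by
      obtain ⟨r, h1, h2⟩ := ((h x hx).and_eventually (Ioo_mem_nhdsGT hδ)).exists
      exact ⟨r, h1, h2⟩) (fun _ => ε / 2) (fun _ _ => half_pos hε)
  have hinj : Set.InjOn (fun x => (x, r x)) T := fun x _ y _ hxy => (Prod.ext_iff.1 hxy).1
  have hS : IsCenteredPacking A ε ((fun x => (x, r x)) '' T) := by
    refine ⟨hT.image _, ?_, ?_, ?_, ?_⟩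
    · rintro _ ⟨x, hx, rfl⟩; exact hTA hx
    · rintro _ ⟨x, hx, rfl⟩; exact (hr x hx).2.1
    · rintro _ ⟨x, hx, rfl⟩
      have := (hr x hx).2.2
      simp only
      linarith
    · rwa [hinj.pairwiseDisjoint_image]
  refine le_trans ?_ (le_iSup₂ (α := ℝ≥0∞) _ hS)
  calc ν A ≤ ν (A \ ⋃ x ∈ T, Metric.closedBall x (r x)) + ν (⋃ x ∈ T, Metric.closedBall x (r x)) :=
        (measure_mono (by rw [sdiff_union_self]; exact subset_union_left)).trans (measure_union_le _ _)
    _ = ν (⋃ x ∈ T, Metric.closedBall x (r x)) := by rw [hcov, zero_add]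
    _ ≤ ∑' x : T, ν (Metric.closedBall x.1 (r x)) := measure_biUnion_le ν hT _
    _ ≤ ∑' x : T, ballPow μ q x.1 (r x) * ENNReal.ofReal ((2 * r x) ^ t) :=
        ENNReal.tsum_le_tsum fun x => (hr x.1 x.2).1
    _ = _ := (tsum_image (fun p : E d × ℝ => ballPow μ q p.1 p.2 * ENNReal.ofReal ((2 * p.2) ^ t))
        hinj).symm

theorem packingPre_mono (μ : Fin k → Measure (E d)) (q : E k) (t : ℝ) {A A' : Set (E d)}
    (hA : A ⊆ A') : packingPre μ q t A ≤ packingPre μ q t A' :=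
  iInf₂_mono fun _ _ => iSup₂_le fun S hS => le_iSup₂ (α := ℝ≥0∞)
    (f := fun (S : Set (E d × ℝ)) (_ : IsCenteredPacking A' _ S) =>
      ∑' p : S, ballPow μ q p.1.1 p.1.2 * ENNReal.ofReal ((2 * p.1.2) ^ t)) S
    ⟨hS.countable, fun p hp => hA (hS.center_mem p hp), hS.radius_pos, hS.diam_lt, hS.disjoint⟩

theorem IsCenteredPacking.tsum_measure_le {A : Set (E d)} {ε : ℝ} {S : Set (E d × ℝ)}
    (hS : IsCenteredPacking A ε S) (ν : Measure (E d)) :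
    ∑' p : S, ν (Metric.closedBall p.1.1 p.1.2) ≤ ν univ :=
  (tsum_meas_le_meas_iUnion_of_disjoint ν (fun _ => Metric.isClosed_closedBall.measurableSet)
    (fun _ _ hne => hS.disjoint (Subtype.prop _) (Subtype.prop _) (Subtype.coe_injective.ne hne))).trans
    (measure_mono (subset_univ _))

/-- Above the Gibbs exponent the packing pre-measure of the support vanishes: a term of a packing
sum is at most the `ν`-measure of its ball times a positive power of the diameter. -/
theorem IsGibbs.packingPre_supp_eq_zero {μ : Fin k → Measure (E d)}
    (hμ : ∀ j, IsFiniteMeasure (μ j)) {ν : Measure (E d)} [IsProbabilityMeasure ν] {q : E k}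
    {t s : ℝ} (h : IsGibbs μ ν q t) (hs : t < s) : packingPre μ q s (supp μ) = 0 := by
  set δ := (s - t) / 2 with hδdef
  have hδ : 0 < δ := half_pos (sub_pos.2 hs)
  obtain ⟨R, hR, hgibbs⟩ := mem_nhdsGT_iff_exists_Ioo_subset.1 (h δ hδ)
  have key : ∀ᶠ ε in 𝓝[>] (0 : ℝ), packingPre μ q s (supp μ) ≤ ENNReal.ofReal (ε ^ δ) := by
    filter_upwards [Ioo_mem_nhdsGT (mem_Ioi.1 hR)] with ε hε
    refine (iInf₂_le ε hε.1).trans (iSup₂_le fun S hS => ?_)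
    have hterm : ∀ p : S, ballPow μ q p.1.1 p.1.2 * ENNReal.ofReal ((2 * p.1.2) ^ s) ≤
        ν (Metric.closedBall p.1.1 p.1.2) * ENNReal.ofReal (ε ^ δ) := by
      rintro ⟨⟨x, r⟩, hp⟩
      have hx : x ∈ supp μ := hS.center_mem _ hp
      have hr : 0 < r := hS.radius_pos _ hp
      have hrε : 2 * r < ε := hS.diam_lt _ hp
      have h2r : 0 < 2 * r := by positivity
      obtain ⟨hy, hy'⟩ := hgibbs ⟨hr, by linarith [hε.2]⟩ x hx
      have h1 := (abs_le.1 hy').1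
      refine le_trans ?_ (mul_le_mul_right (ENNReal.ofReal_le_ofReal
        (Real.rpow_le_rpow h2r.le hrε.le hδ.le)) _)
      simp only
      rw [ballPow_mul_rpow hμ q s hx hr, ← ofReal_measureReal (μ := ν), ← Real.exp_log hy,
        Real.rpow_def_of_pos h2r, ← ENNReal.ofReal_mul (Real.exp_pos _).le, ← Real.exp_add]
      refine ENNReal.ofReal_le_ofReal (Real.exp_le_exp.2 ?_)
      have h2 : s * Real.log (2 * r) = t * Real.log (2 * r) + 2 * (δ * Real.log (2 * r)) := by
        rw [hδdef]; ring
      linarith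
    calc _ ≤ ∑' p : S, ν (Metric.closedBall p.1.1 p.1.2) * ENNReal.ofReal (ε ^ δ) :=
          ENNReal.tsum_le_tsum hterm
      _ ≤ 1 * ENNReal.ofReal (ε ^ δ) := by
          rw [ENNReal.tsum_mul_right]
          gcongr
          simpa using hS.tsum_measure_le ν
      _ = _ := one_mul _
  have hlim : Tendsto (fun ε : ℝ => ENNReal.ofReal (ε ^ δ)) (𝓝[>] 0) (𝓝 0) := by
    have h1 : Tendsto (fun ε : ℝ => ε ^ δ) (𝓝 0) (𝓝 0) := by
      simpa [Real.zero_rpow hδ.ne'] using (Real.continuousAt_rpow_const 0 δ (Or.inr hδ.le)).tendsto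
    simpa using (ENNReal.tendsto_ofReal h1).mono_left nhdsWithin_le_nhds
  exact le_antisymm (ge_of_tendsto hlim key) zero_le

/-- Below the Gibbs exponent the packing measure of the support is at least the mass of the Gibbs
measure. -/
theorem IsGibbs.one_le_packingMeasure {μ : Fin k → Measure (E d)}
    (hμ : ∀ j, IsFiniteMeasure (μ j)) {ν : Measure (E d)} [IsProbabilityMeasure ν]
    (hν : ν (supp μ)ᶜ = 0) {q : E k} {t s : ℝ} (h : IsGibbs μ ν q t) (hs : s < t) :
    1 ≤ packingMeasure μ q s (supp μ) := by
  refine le_iInf₂ fun F hF => ?_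
  have hpiece : ∀ i, ν (supp μ ∩ F i) ≤ packingPre μ q s (F i) := fun i => by
    refine (measure_le_packingPre μ ν q s _ fun x hx => Eventually.frequently ?_).trans
      (packingPre_mono μ q s inter_subset_right)
    filter_upwards [h _ (sub_pos.2 hs), self_mem_nhdsWithin] with r hr hr0
    obtain ⟨hy, hy'⟩ := hr x hx.1
    rw [ballPow_mul_rpow hμ q s hx.1 hr0, ← ofReal_measureReal (μ := ν), ← Real.exp_log hy]
    refine ENNReal.ofReal_le_ofReal (Real.exp_le_exp.2 ?_)
    linarith [(abs_le.1 hy').2]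
  calc (1 : ℝ≥0∞) = ν univ := measure_univ.symm
    _ ≤ ν (supp μ) + ν (supp μ)ᶜ := by
        rw [← union_compl_self (supp μ)]; exact measure_union_le _ _
    _ = ν (supp μ) := by rw [hν, add_zero]
    _ ≤ ν (⋃ i, supp μ ∩ F i) := measure_mono (by rw [← inter_iUnion]; exact subset_inter le_rfl hF)
    _ ≤ ∑' i, ν (supp μ ∩ F i) := measure_iUnion_le _
    _ ≤ _ := ENNReal.tsum_le_tsum hpiece

/-- The existence of a Gibbs measure identifies `B_μ(q)` with its exponent. -/
theorem IsGibbs.B_eq {μ : Fin k → Measure (E d)}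
    (hμ : ∀ j, IsFiniteMeasure (μ j)) {ν : Measure (E d)} [IsProbabilityMeasure ν]
    (hν : ν (supp μ)ᶜ = 0) {q : E k} {t : ℝ} (h : IsGibbs μ ν q t) : B μ q = t := by
  refine le_antisymm (EReal.le_of_forall_lt_iff_le.1 fun s hs => ?_) (le_iInf₂ fun s hs => ?_)
  · refine iInf₂_le (α := EReal) s (le_antisymm (α := ℝ≥0∞) ?_ zero_le)
    refine (iInf₂_le (fun _ => supp μ) (subset_iUnion (fun _ : ℕ => supp μ) 0)).trans ?_
    simp [h.packingPre_supp_eq_zero hμ (EReal.coe_lt_coe_iff.1 hs)]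
  · by_contra! hlt
    have := h.one_le_packingMeasure hμ hν (EReal.coe_lt_coe_iff.1 hlt)
    simp [hs] at this

/-! ### Local dimensions -/

theorem tendsto_log_two_mul_div_log :
    Tendsto (fun r : ℝ => Real.log (2 * r) / Real.log r) (𝓝[>] 0) (𝓝 1) := by
  have h : Tendsto (fun r : ℝ => Real.log 2 / Real.log r + 1) (𝓝[>] 0) (𝓝 (0 + 1)) :=
    (Real.tendsto_log_nhdsGT_zero.const_div_atBot _).add_const 1
  rw [zero_add] at h
  refine h.congr' ?_
  filter_upwards [Ioo_mem_nhdsGT one_pos] with r hr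
  have : Real.log r ≠ 0 := (Real.log_neg hr.1 hr.2).ne
  rw [Real.log_mul two_ne_zero hr.1.ne']
  field_simp

/-- At a point of the support, the local dimension may be computed as a limit of real quotients,
with the diameter of the ball in place of its radius. -/
theorem hasLocalDim_iff_tendsto {μ : Fin k → Measure (E d)} (hμ : ∀ j, IsFiniteMeasure (μ j))
    {x : E d} (hx : x ∈ supp μ) (a : E k) :
    HasLocalDim μ x a ↔ ∀ j, Tendsto
      (fun r : ℝ => Real.log ((μ j).real (Metric.closedBall x r)) / Real.log (2 * r))
      (𝓝[>] 0) (𝓝 (a j)) := by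
  refine forall_congr' fun j => ?_
  have := hμ j
  have hcoe : (fun r : ℝ => ENNReal.log (μ j (Metric.closedBall x r)) / (Real.log r : EReal))
      =ᶠ[𝓝[>] 0] fun r : ℝ =>
        ((Real.log ((μ j).real (Metric.closedBall x r)) / Real.log r : ℝ) : EReal) := by
    filter_upwards [self_mem_nhdsWithin] with r hr
    rw [← ofReal_measureReal (μ := μ j), ENNReal.log_ofReal,
      if_neg (measureReal_closedBall_pos hμ hx hr j).not_ge, EReal.coe_div]
  have hlim : (lowerLocalDim (μ j) x = a j ∧ upperLocalDim (μ j) x = a j) ↔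
      Tendsto (fun r : ℝ => Real.log ((μ j).real (Metric.closedBall x r)) / Real.log r)
        (𝓝[>] 0) (𝓝 (a j)) := by
    rw [← EReal.tendsto_coe, lowerLocalDim, upperLocalDim, liminf_congr hcoe, limsup_congr hcoe]
    exact ⟨fun h => tendsto_of_le_liminf_of_limsup_le h.1.ge h.2.le,
      fun h => ⟨h.liminf_eq, h.limsup_eq⟩⟩
  have hne : ∀ᶠ r in 𝓝[>] (0 : ℝ), Real.log r ≠ 0 ∧ Real.log (2 * r) ≠ 0 := by
    filter_upwards [Ioo_mem_nhdsGT (half_pos one_pos)] with r hr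
    exact ⟨(Real.log_neg hr.1 (by linarith [hr.2])).ne,
      (Real.log_neg (by linarith [hr.1]) (by linarith [hr.2])).ne⟩
  rw [hlim]
  constructor <;> intro h
  · have h' := h.div tendsto_log_two_mul_div_log one_ne_zero
    rw [div_one] at h'
    refine h'.congr' ?_
    filter_upwards [hne] with r ⟨h1, h2⟩
    simp only [Pi.div_apply]
    field_simp
  · have h' := h.mul tendsto_log_two_mul_div_log
    rw [mul_one] at h'
    refine h'.congr' ?_
    filter_upwards [hne] with r ⟨h1, h2⟩
    field_simp

theorem mem_lowerSet_inter_upperSet_iff {μ : Fin k → Measure (E d)} {a : E k} {x : E d} :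
    x ∈ lowerSet μ a ∩ upperSet μ a ↔ x ∈ supp μ ∧ HasLocalDim μ x a := by
  constructor
  · rintro ⟨⟨hx, hl⟩, -, hu⟩
    have hlu : ∀ j, lowerLocalDim (μ j) x ≤ upperLocalDim (μ j) x := fun j => liminf_le_limsup
    exact ⟨hx, fun j => ⟨((hlu j).trans (hu j)).antisymm (hl j),
      (hu j).antisymm ((hl j).trans (hlu j))⟩⟩
  · rintro ⟨hx, h⟩
    exact ⟨⟨hx, fun j => (h j).1.ge⟩, hx, fun j => (h j).2.le⟩

/-- A tilting estimate: Gibbs measures `ν` at `q` and `ν'` at `q + p` can be compared through the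
packing pre-measure with exponent `q + p`, which bounds `ν` on the set of points where
`(μ(B(x,r)))^p ≥ (2r)^{-c}` at arbitrarily small scales and vanishes because of `ν'`. -/
theorem IsGibbs.ae_eventually_logBallPow_lt {μ : Fin k → Measure (E d)}
    (hμ : ∀ j, IsFiniteMeasure (μ j)) {ν ν' : Measure (E d)} [IsProbabilityMeasure ν]
    [IsProbabilityMeasure ν'] (hν : ν (supp μ)ᶜ = 0) {q p : E k} {t t' c : ℝ}
    (h : IsGibbs μ ν q t) (h' : IsGibbs μ ν' (q + p) t') (hc : t' < t + c) :
    ∀ᵐ x ∂ν, ∀ᶠ r in 𝓝[>] (0 : ℝ), logBallPow μ p x r + c * Real.log (2 * r) < 0 := by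
  set δ := (t + c - t') / 2 with hδdef
  have hδ : 0 < δ := half_pos (sub_pos.2 hc)
  set Y := {x ∈ supp μ | ∃ᶠ r in 𝓝[>] (0 : ℝ), 0 ≤ logBallPow μ p x r + c * Real.log (2 * r)}
  have hY : ν Y = 0 := by
    refine le_antisymm ?_ zero_le
    rw [← h'.packingPre_supp_eq_zero hμ (lt_add_of_pos_right t' hδ)]
    refine (measure_le_packingPre μ ν (q + p) (t' + δ) Y fun x hx => ?_).trans
      (packingPre_mono _ _ _ fun x hx => hx.1)
    refine (hx.2.and_eventually ((h δ hδ).and self_mem_nhdsWithin)).mono ?_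
    rintro r ⟨hbad, hr, hr0⟩
    obtain ⟨hy, hy'⟩ := hr x hx.1
    rw [ballPow_mul_rpow hμ _ _ hx.1 hr0, ← ofReal_measureReal (μ := ν), ← Real.exp_log hy]
    refine ENNReal.ofReal_le_ofReal (Real.exp_le_exp.2 ?_)
    have h1 := (abs_le.1 hy').2
    have h2 : (t' + δ) * Real.log (2 * r) =
        t * Real.log (2 * r) + c * Real.log (2 * r) - δ * Real.log (2 * r) := by
      rw [hδdef]; ring
    rw [logBallPow_add]
    linarith
  have hsupp : ∀ᵐ x ∂ν, x ∈ supp μ := hν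
  filter_upwards [hsupp, measure_eq_zero_iff_ae_notMem.1 hY] with x hx hxY
  by_contra hcon
  exact hxY ⟨hx, (not_eventually.1 hcon).mono fun r hr => not_lt.1 hr⟩

/-- Tilting by `±s eⱼ` with `s` small turns differentiability of the Gibbs exponent at `q` into
bounds on the `j`-th local dimension. -/
theorem ae_hasLocalDim_of_hasGradientAt {μ : Fin k → Measure (E d)}
    (hμ : ∀ j, IsFiniteMeasure (μ j)) {ν : E k → Measure (E d)} {t : E k → ℝ}
    (hprob : ∀ q, IsProbabilityMeasure (ν q)) (hν : ∀ q, ν q (supp μ)ᶜ = 0)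
    (hG : ∀ q, IsGibbs μ (ν q) q (t q)) {q v : E k} (hv : HasGradientAt t v q) :
    ∀ᵐ x ∂(ν q), HasLocalDim μ x (-v) := by
  have htilt : ∀ (j : Fin k) (s a : ℝ), t (q + EuclideanSpace.single j s) < t q + -(s * a) →
      ∀ᵐ x ∂(ν q), ∀ᶠ r in 𝓝[>] (0 : ℝ),
        s * (Real.log ((μ j).real (Metric.closedBall x r)) - a * Real.log (2 * r)) < 0 := by
    intro j s a hs
    filter_upwards [(hG q).ae_eventually_logBallPow_lt hμ (hν q) (hG _) hs] with x hx
    filter_upwards [hx] with r hr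
    rw [logBallPow_single] at hr
    linarith
  have hslope : ∀ j, Tendsto (fun s : ℝ => s⁻¹ * (t (q + EuclideanSpace.single j s) - t q))
      (𝓝[≠] 0) (𝓝 (v j)) := by
    intro j
    have hline : HasLineDerivAt ℝ t (v j) q (EuclideanSpace.single j (1 : ℝ)) := by
      have h1 := hv.hasFDerivAt.hasLineDerivAt (EuclideanSpace.single j (1 : ℝ))
      simpa [EuclideanSpace.inner_single_right] using h1
    have h2 := hline.tendsto_slope_zero
    refine h2.congr fun s => ?_
    have h3 : s • EuclideanSpace.single j (1 : ℝ) = EuclideanSpace.single j s := by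
      ext i; simp [PiLp.single_apply]
    rw [smul_eq_mul, h3]
  have hupper : ∀ (j : Fin k) (a : ℝ), -v j < a → ∀ᵐ x ∂(ν q), ∀ᶠ r in 𝓝[>] (0 : ℝ),
      Real.log ((μ j).real (Metric.closedBall x r)) / Real.log (2 * r) < a := by
    intro j a ha
    have h1 : ∀ᶠ s in 𝓝[<] (0 : ℝ), -a < s⁻¹ * (t (q + EuclideanSpace.single j s) - t q) :=
      ((hslope j).mono_left (nhdsLT_le_nhdsNE 0)).eventually_const_lt (by linarith)
    obtain ⟨s, hs, hs0⟩ := (h1.and self_mem_nhdsWithin).exists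
    replace hs0 : s < 0 := hs0
    rw [inv_mul_eq_div, lt_div_iff_of_neg hs0] at hs
    filter_upwards [htilt j s a (by linarith)] with x hx
    filter_upwards [hx, tendsto_log_two_mul.eventually_lt_atBot 0] with r hr hr0
    rw [div_lt_iff_of_neg hr0]
    exact sub_pos.1 (pos_of_mul_neg_right hr hs0.le)
  have hlower : ∀ (j : Fin k) (a : ℝ), a < -v j → ∀ᵐ x ∂(ν q), ∀ᶠ r in 𝓝[>] (0 : ℝ),
      a < Real.log ((μ j).real (Metric.closedBall x r)) / Real.log (2 * r) := by
    intro j a ha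
    have h1 : ∀ᶠ s in 𝓝[>] (0 : ℝ), s⁻¹ * (t (q + EuclideanSpace.single j s) - t q) < -a :=
      ((hslope j).mono_left (nhdsGT_le_nhdsNE 0)).eventually_lt_const (by linarith)
    obtain ⟨s, hs, hs0⟩ := (h1.and self_mem_nhdsWithin).exists
    replace hs0 : 0 < s := hs0
    rw [inv_mul_eq_div, div_lt_iff₀ hs0] at hs
    filter_upwards [htilt j s a (by linarith)] with x hx
    filter_upwards [hx, tendsto_log_two_mul.eventually_lt_atBot 0] with r hr hr0
    rw [lt_div_iff_of_neg hr0]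
    exact sub_neg.1 (neg_of_mul_neg_right hr hs0.le)
  have hU : ∀ᵐ x ∂(ν q), ∀ (j : Fin k) (n : ℕ), ∀ᶠ r in 𝓝[>] (0 : ℝ),
      Real.log ((μ j).real (Metric.closedBall x r)) / Real.log (2 * r) < -v j + 1 / (n + 1) :=
    ae_all_iff.2 fun j => ae_all_iff.2 fun n => hupper j _ (lt_add_of_pos_right _ (by positivity))
  have hL : ∀ᵐ x ∂(ν q), ∀ (j : Fin k) (n : ℕ), ∀ᶠ r in 𝓝[>] (0 : ℝ),
      -v j - 1 / (n + 1) < Real.log ((μ j).real (Metric.closedBall x r)) / Real.log (2 * r) :=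
    ae_all_iff.2 fun j => ae_all_iff.2 fun n => hlower j _ (sub_lt_self _ (by positivity))
  have hsupp : ∀ᵐ x ∂(ν q), x ∈ supp μ := hν q
  filter_upwards [hsupp, hU, hL] with x hx hxU hxL
  refine (hasLocalDim_iff_tendsto hμ hx _).2 fun j => tendsto_order.2 ⟨fun a ha => ?_, fun a ha => ?_⟩
  · rw [PiLp.neg_apply] at ha
    obtain ⟨n, hn⟩ := exists_nat_one_div_lt (sub_pos.2 ha)
    filter_upwards [hxL j n] with r hr
    linarith
  · rw [PiLp.neg_apply] at ha
    obtain ⟨n, hn⟩ := exists_nat_one_div_lt (sub_pos.2 ha)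
    filter_upwards [hxU j n] with r hr
    linarith

/-- Where `μ` has local dimension `a`, a Gibbs measure with exponents `(q, t)` has local dimension
`⟨a, q⟩ + t`. -/
theorem IsGibbs.tendsto_log_div_log {μ : Fin k → Measure (E d)}
    (hμ : ∀ j, IsFiniteMeasure (μ j)) {ν : Measure (E d)} {q : E k} {t : ℝ}
    (h : IsGibbs μ ν q t) {a : E k} {x : E d} (hx : x ∈ supp μ) (ha : HasLocalDim μ x a) :
    Tendsto (fun r : ℝ => Real.log (ν.real (Metric.closedBall x r)) / Real.log (2 * r))
      (𝓝[>] 0) (𝓝 (inner ℝ a q + t)) := by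
  have h1 : Tendsto (fun r : ℝ => (∑ j, q j *
      (Real.log ((μ j).real (Metric.closedBall x r)) / Real.log (2 * r))) + t)
      (𝓝[>] 0) (𝓝 (inner ℝ a q + t)) := by
    rw [PiLp.inner_apply]
    exact (tendsto_finsetSum _ fun j _ =>
      (((hasLocalDim_iff_tendsto hμ hx a).1 ha j).const_mul (q j))).add_const t
  have h2 : Tendsto (fun r : ℝ => Real.log (ν.real (Metric.closedBall x r)) / Real.log (2 * r) -
      ((∑ j, q j * (Real.log ((μ j).real (Metric.closedBall x r)) / Real.log (2 * r))) + t))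
      (𝓝[>] 0) (𝓝 0) := by
    rw [Metric.tendsto_nhds]
    intro ε hε
    filter_upwards [h _ (half_pos hε), tendsto_log_two_mul.eventually_lt_atBot 0] with r hr hr0
    have hr' := (hr x hx).2
    have heq : Real.log (ν.real (Metric.closedBall x r)) / Real.log (2 * r) -
      ((∑ j, q j * (Real.log ((μ j).real (Metric.closedBall x r)) / Real.log (2 * r))) + t) =
      (Real.log (ν.real (Metric.closedBall x r)) - (logBallPow μ q x r + t * Real.log (2 * r))) /
        Real.log (2 * r) := by
      have := hr0.ne
      simp only [logBallPow, ← mul_div_assoc, ← Finset.sum_div]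
      field_simp
    rw [Real.dist_eq, sub_zero, heq, abs_div, abs_of_neg hr0, div_lt_iff₀ (neg_pos.2 hr0)]
    have := mul_lt_mul_of_pos_right (half_lt_self hε) (neg_pos.2 hr0)
    linarith
  simpa using h2.add h1

/-! ### Hausdorff dimension and the growth of measures -/

/-- Upper half of Billingsley's lemma: the enlargements of a Vitali family of balls cover `A`, and
their diameters are controlled by the masses of the disjoint balls. -/
theorem dimH_le_of_frequently_le_measure (ν : Measure (E d)) [IsFiniteMeasure ν] (A : Set (E d))
    (s : NNReal) (h : ∀ x ∈ A, ∃ᶠ r in 𝓝[>] (0 : ℝ),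
      ENNReal.ofReal ((2 * r) ^ (s : ℝ)) ≤ ν (Metric.closedBall x r)) : dimH A ≤ s := by
  refine dimH_le_of_hausdorffMeasure_ne_top ?_
  have hr : ∀ (n : ℕ) (x : E d), ∃ r : ℝ, x ∈ A → r ∈ Ioo (0 : ℝ) (1 / (n + 1)) ∧
      ENNReal.ofReal ((2 * r) ^ (s : ℝ)) ≤ ν (Metric.closedBall x r) := fun n x => by
    by_cases hx : x ∈ A
    · obtain ⟨r, h1, h2⟩ := ((h x hx).and_eventually (Ioo_mem_nhdsGT
        (show (0 : ℝ) < 1 / (n + 1) by positivity))).exists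
      exact ⟨r, fun _ => ⟨h2, h1⟩⟩
    · exact ⟨0, fun hx' => absurd hx' hx⟩
  choose r hr using hr
  have hu : ∀ n : ℕ, ∃ u ⊆ A, (u.PairwiseDisjoint fun x => Metric.closedBall x (r n x)) ∧
      ∀ x ∈ A, ∃ y ∈ u, Metric.closedBall x (r n x) ⊆ Metric.closedBall y (5 * r n y) := fun n =>
    Vitali.exists_disjoint_subfamily_covering_enlargement_closedBall A id (r n) (1 / (n + 1))
      (fun x hx => (hr n x hx).1.2.le) 5 (by norm_num)
  choose u huA hdisj hcov using hu
  have hcount : ∀ n, Countable (u n) := fun n =>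
    ((hdisj n).countable_of_nonempty_interior fun x hx =>
      ⟨x, mem_interior_iff_mem_nhds.2
        (Metric.closedBall_mem_nhds x (hr n x (huA n hx)).1.1)⟩).to_subtype
  have hdiam : ∀ n (x : u n), Metric.ediam (Metric.closedBall (x : E d) (5 * r n x)) ≤
      ENNReal.ofReal (5 * (2 * r n x)) := fun n x => by
    refine Metric.ediam_le fun y hy z hz => ?_
    rw [edist_dist]
    refine ENNReal.ofReal_le_ofReal ?_
    have := dist_triangle_right y z (x : E d)
    rw [Metric.mem_closedBall] at hy hz
    linarith
  have hscale : Tendsto (fun n : ℕ => ENNReal.ofReal (10 * (1 / ((n : ℝ) + 1)))) atTop (𝓝 0) := by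
    simpa using ENNReal.tendsto_ofReal (tendsto_one_div_add_atTop_nhds_zero_nat.const_mul (10 : ℝ))
  have hsum : ∀ n, ∑' x : u n, Metric.ediam (Metric.closedBall (x : E d) (5 * r n x)) ^ (s : ℝ) ≤
      ENNReal.ofReal (5 ^ (s : ℝ)) * ν univ := fun n => by
    calc _ ≤ ∑' x : u n, ENNReal.ofReal (5 ^ (s : ℝ)) * ν (Metric.closedBall (x : E d) (r n x)) := by
          refine ENNReal.tsum_le_tsum fun x => ?_
          obtain ⟨hr1, hr2⟩ := hr n x (huA n x.2)
          refine (ENNReal.rpow_le_rpow (hdiam n x) s.2).trans ?_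
          rw [ENNReal.ofReal_rpow_of_pos (by linarith [hr1.1]),
            Real.mul_rpow (by norm_num) (by linarith [hr1.1]), ENNReal.ofReal_mul (by positivity)]
          exact mul_le_mul_right hr2 _
      _ ≤ _ := by
          rw [ENNReal.tsum_mul_left]
          gcongr
          exact (tsum_meas_le_meas_iUnion_of_disjoint ν
            (fun _ => Metric.isClosed_closedBall.measurableSet) (fun _ _ hne =>
              hdisj n (Subtype.prop _) (Subtype.prop _) (Subtype.coe_injective.ne hne))).trans
            (measure_mono (subset_univ _))
  refine ne_top_of_le_ne_top (ENNReal.mul_ne_top ENNReal.ofReal_ne_top (measure_ne_top ν univ))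
    ((Measure.hausdorffMeasure_le_liminf_tsum (ι := fun n => u n) (s : ℝ) A _ hscale
      (fun n x => Metric.closedBall (x : E d) (5 * r n x)) ?_ ?_).trans
      (liminf_le_of_frequently_le' (Frequently.of_forall hsum)))
  · refine Eventually.of_forall fun n x => (hdiam n x).trans (ENNReal.ofReal_le_ofReal ?_)
    linarith [(hr n x (huA n x.2)).1.2]
  · refine Eventually.of_forall fun n x hx => ?_
    obtain ⟨y, hy, hxy⟩ := hcov n x hx
    exact mem_iUnion.2 ⟨⟨y, hy⟩, hxy (Metric.mem_closedBall_self (hr n x hx).1.1.le)⟩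

/-- The mass distribution principle, in its local form. -/
theorem le_dimH_of_eventually_measure_le (ν : Measure (E d)) (A : Set (E d)) (hA : ν A ≠ 0)
    (s : NNReal) (h : ∀ x ∈ A, ∀ᶠ r in 𝓝[>] (0 : ℝ),
      ν (Metric.closedBall x r) ≤ ENNReal.ofReal ((2 * r) ^ (s : ℝ))) : s ≤ dimH A := by
  -- On one of the pieces `A' n` of positive mass the growth bound holds below a uniform scale.
  let A' : ℕ → Set (E d) := fun n => {x ∈ A | ∀ r ∈ Ioo (0 : ℝ) (1 / (n + 1)),
    ν (Metric.closedBall x r) ≤ ENNReal.ofReal ((2 * r) ^ (s : ℝ))}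
  have hcov : A ⊆ ⋃ n, A' n := fun x hx => by
    obtain ⟨R, hR, hRs⟩ := mem_nhdsGT_iff_exists_Ioo_subset.1 (h x hx)
    obtain ⟨n, hn⟩ := exists_nat_one_div_lt (mem_Ioi.1 hR)
    exact mem_iUnion.2 ⟨n, hx, fun r hr => hRs ⟨hr.1, hr.2.trans hn⟩⟩
  obtain ⟨n, hn⟩ : ∃ n, ν (A' n) ≠ 0 := by
    by_contra! hcon
    exact hA (measure_mono_null hcov (measure_iUnion_null hcon))
  set c : ℝ≥0∞ := ENNReal.ofReal (2 ^ (s : ℝ)) with hc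
  have hc0 : c ≠ 0 := by
    rw [hc, Ne, ENNReal.ofReal_eq_zero, not_le]; positivity
  have hle : c⁻¹ • ν.restrict (A' n) ≤ Measure.hausdorffMeasure (s : ℝ) := by
    refine Measure.le_hausdorffMeasure _ _ (ENNReal.ofReal (1 / (n + 2)))
      (ENNReal.ofReal_pos.2 (by positivity)) fun u hu => ?_
    rw [Measure.smul_apply, smul_eq_mul, ENNReal.inv_mul_le_iff hc0 ENNReal.ofReal_ne_top]
    -- Passing to the closure makes the set measurable without changing its diameter.
    refine (measure_mono subset_closure).trans ?_
    rw [Measure.restrict_apply isClosed_closure.measurableSet, ← Metric.ediam_closure u]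
    rw [← Metric.ediam_closure u] at hu
    rcases (closure u ∩ A' n).eq_empty_or_nonempty with h0 | ⟨x, hxu, hxA⟩
    · simp [h0]
    set D := Metric.ediam (closure u)
    have hDtop : D ≠ ⊤ := ne_top_of_le_ne_top ENNReal.ofReal_ne_top hu
    have hD : D.toReal < 1 / (n + 1) :=
      (ENNReal.toReal_le_of_le_ofReal (by positivity) hu).trans_lt (by gcongr; norm_num)
    have hbound : ∀ᶠ r in 𝓝[>] D.toReal,
        ν (closure u ∩ A' n) ≤ ENNReal.ofReal ((2 * r) ^ (s : ℝ)) := by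
      filter_upwards [Ioo_mem_nhdsGT hD] with r hr
      refine (measure_mono fun y hy => ?_).trans
        (hxA.2 r ⟨ENNReal.toReal_nonneg.trans_lt hr.1, hr.2⟩)
      rw [Metric.mem_closedBall, dist_edist]
      exact (ENNReal.toReal_mono hDtop (Metric.edist_le_ediam_of_mem hy.1 hxu)).trans hr.1.le
    have hcont : Tendsto (fun r : ℝ => ENNReal.ofReal ((2 * r) ^ (s : ℝ))) (𝓝[>] D.toReal)
        (𝓝 (ENNReal.ofReal ((2 * D.toReal) ^ (s : ℝ)))) := by
      refine (ENNReal.continuous_ofReal.tendsto _).comp (Tendsto.mono_left ?_ nhdsWithin_le_nhds)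
      exact ((continuous_const.mul continuous_id).rpow_const fun _ => Or.inr s.2).tendsto _
    refine (ge_of_tendsto hcont hbound).trans_eq ?_
    rw [Real.mul_rpow two_pos.le ENNReal.toReal_nonneg, ENNReal.ofReal_mul (by positivity),
      ← ENNReal.ofReal_rpow_of_nonneg ENNReal.toReal_nonneg s.coe_nonneg, ENNReal.ofReal_toReal hDtop]
  refine (le_dimH_of_hausdorffMeasure_ne_zero fun h0 => hn ?_).trans
    (dimH_mono fun x (hx : x ∈ A' n) => hx.1)
  have h1 := hle (A' n)
  rw [h0, Measure.smul_apply, Measure.restrict_apply_self, smul_eq_mul, nonpos_iff_eq_zero,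
    mul_eq_zero] at h1
  exact h1.resolve_left (ENNReal.inv_ne_zero.2 ENNReal.ofReal_ne_top)

/-! ### The spectrum and the Legendre transform -/

theorem IsGibbs.spectrum_le {μ : Fin k → Measure (E d)} (hμ : ∀ j, IsFiniteMeasure (μ j))
    {ν : Measure (E d)} [IsProbabilityMeasure ν] {q : E k} {t : ℝ} (h : IsGibbs μ ν q t) {a : E k}
    (hne : (lowerSet μ a ∩ upperSet μ a).Nonempty) :
    (spectrum μ a : EReal) ≤ ((inner ℝ a q + t : ℝ) : EReal) := by
  have hgrowth : ∀ s : ℝ, inner ℝ a q + t < s → ∀ x ∈ lowerSet μ a ∩ upperSet μ a,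
      ∀ᶠ r in 𝓝[>] (0 : ℝ), (2 * r) ^ s ≤ ν.real (Metric.closedBall x r) := by
    intro s hs x hx
    rw [mem_lowerSet_inter_upperSet_iff] at hx
    filter_upwards [(h.tendsto_log_div_log hμ hx.1 hx.2).eventually_lt_const hs, h 1 one_pos,
      tendsto_log_two_mul.eventually_lt_atBot 0, self_mem_nhdsWithin] with r h1 h2 h3 h4
    rw [div_lt_iff_of_neg h3] at h1
    rw [Real.rpow_def_of_pos (mul_pos two_pos h4), ← Real.le_log_iff_exp_le (h2 x hx.1).1, mul_comm]
    exact h1.le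
  refine EReal.le_of_forall_lt_iff_le.1 fun s hs => ?_
  rw [EReal.coe_lt_coe_iff] at hs
  -- The exponent is nonnegative, because a negative power of `2r` would exceed the total mass.
  have hs0 : 0 ≤ s := by
    obtain ⟨x, hx⟩ := hne
    obtain ⟨r, h1, h2⟩ :=
      ((hgrowth s hs x hx).and (Ioo_mem_nhdsGT (half_pos one_pos))).exists
    by_contra! hneg
    have h3 : 1 < (2 * r) ^ s := Real.one_lt_rpow_of_pos_of_lt_one_of_neg
      (by linarith [h2.1]) (by linarith [h2.2]) hneg
    linarith [measureReal_le_one (μ := ν) (s := Metric.closedBall x r)]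
  lift s to NNReal using hs0
  have hdim : spectrum μ a ≤ (s : ℝ≥0∞) :=
    dimH_le_of_frequently_le_measure ν _ s fun x hx => ((hgrowth s hs x hx).mono fun r hr => by
      rw [← ofReal_measureReal (μ := ν)]
      exact ENNReal.ofReal_le_ofReal hr).frequently
  exact (EReal.coe_ennreal_le_coe_ennreal_iff.2 hdim).trans_eq
    (EReal.coe_nnreal_eq_coe_real s)

theorem IsGibbs.le_spectrum {μ : Fin k → Measure (E d)} (hμ : ∀ j, IsFiniteMeasure (μ j))
    {ν : Measure (E d)} [IsProbabilityMeasure ν] {q : E k} {t : ℝ} (h : IsGibbs μ ν q t) {a : E k}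
    (hpos : ν (lowerSet μ a ∩ upperSet μ a) ≠ 0) :
    ((inner ℝ a q + t : ℝ) : EReal) ≤ (spectrum μ a : EReal) := by
  refine EReal.ge_of_forall_gt_iff_ge.1 fun s hs => ?_
  rw [EReal.coe_lt_coe_iff] at hs
  rcases le_total s 0 with hs0 | hs0
  · exact (EReal.coe_nonpos.2 hs0).trans (EReal.coe_ennreal_nonneg _)
  lift s to NNReal using hs0
  have hdim : (s : ℝ≥0∞) ≤ spectrum μ a := by
    refine le_dimH_of_eventually_measure_le ν _ hpos s fun x hx => ?_
    rw [mem_lowerSet_inter_upperSet_iff] at hx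
    filter_upwards [(h.tendsto_log_div_log hμ hx.1 hx.2).eventually_const_lt hs, h 1 one_pos,
      tendsto_log_two_mul.eventually_lt_atBot 0, self_mem_nhdsWithin] with r h1 h2 h3 h4
    rw [lt_div_iff_of_neg h3] at h1
    rw [← ofReal_measureReal (μ := ν)]
    refine ENNReal.ofReal_le_ofReal ?_
    rw [Real.rpow_def_of_pos (mul_pos two_pos h4), ← Real.log_le_iff_le_exp (h2 x hx.1).1, mul_comm]
    exact h1.le
  exact (EReal.coe_nnreal_eq_coe_real s).ge.trans (EReal.coe_ennreal_le_coe_ennreal_iff.2 hdim)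

end MixedMultifractal

theorem mainTheorem2 {d k : ℕ}
    (μ : Fin k → Measure (MixedMultifractal.E d)) (hμ : ∀ j, IsProbabilityMeasure (μ j))
    (t r₀ K₁ K₂ : MixedMultifractal.E k → ℝ)
    (ν : MixedMultifractal.E k → Measure (MixedMultifractal.E d))
    (φ : MixedMultifractal.E k → ℝ → ℝ) (ρ : MixedMultifractal.E k → ℕ → ℝ)
    (h : ∀ q, MixedMultifractal.GibbsHypotheses μ q (t q) (r₀ q) (K₁ q) (K₂ q) (ν q) (φ q) (ρ q)) :
    (∀ q v, MixedMultifractal.HasGrad (MixedMultifractal.B μ) v q →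
      ∀ᵐ x ∂(ν q), MixedMultifractal.HasLocalDim μ x (-v)) ∧
    MixedMultifractal.negGradients (MixedMultifractal.B μ) ⊆
      MixedMultifractal.localDimImage μ (MixedMultifractal.supp μ) ∧
    ∀ a ∈ MixedMultifractal.negGradients (MixedMultifractal.B μ),
      (MixedMultifractal.spectrum μ a : EReal) =
        MixedMultifractal.legendre (MixedMultifractal.B μ) a := by
  have hfin : ∀ j, IsFiniteMeasure (μ j) := fun j => inferInstance
  have hprob : ∀ q, IsProbabilityMeasure (ν q) := fun q => (h q).prob
  have hν : ∀ q, ν q (MixedMultifractal.supp μ)ᶜ = 0 := fun q => (h q).supported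
  have hG : ∀ q, MixedMultifractal.IsGibbs μ (ν q) q (t q) := fun q => (h q).isGibbs hfin
  have hB : ∀ q, MixedMultifractal.B μ q = t q := fun q => (hG q).B_eq hfin (hν q)
  have hae : ∀ q v, MixedMultifractal.HasGrad (MixedMultifractal.B μ) v q →
      ∀ᵐ x ∂(ν q), MixedMultifractal.HasLocalDim μ x (-v) := fun q v hv =>
    MixedMultifractal.ae_hasLocalDim_of_hasGradientAt hfin hprob hν hG
      (by simpa only [hB, EReal.toReal_coe] using hv.2)
  have hfull : ∀ q v, MixedMultifractal.HasGrad (MixedMultifractal.B μ) v q →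
      ∀ᵐ x ∂(ν q), x ∈ MixedMultifractal.lowerSet μ (-v) ∩ MixedMultifractal.upperSet μ (-v) := by
    intro q v hv
    have hsupp : ∀ᵐ x ∂(ν q), x ∈ MixedMultifractal.supp μ := hν q
    filter_upwards [hsupp, hae q v hv] with x hx hxa
    exact MixedMultifractal.mem_lowerSet_inter_upperSet_iff.2 ⟨hx, hxa⟩
  refine ⟨hae, ?_, ?_⟩
  · rintro a ⟨q, v, hv, rfl⟩
    obtain ⟨x, hx⟩ := (hfull q v hv).exists
    exact ⟨x, MixedMultifractal.mem_lowerSet_inter_upperSet_iff.1 hx⟩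
  · rintro a ⟨q, v, hv, rfl⟩
    refine le_antisymm (le_iInf fun p => ?_) ((iInf_le _ q).trans ?_)
    · rw [hB, ← EReal.coe_add]
      exact (hG p).spectrum_le hfin (hfull q v hv).exists
    · rw [hB, ← EReal.coe_add]
      exact (hG q).le_spectrum hfin (frequently_ae_mem_iff.1 (hfull q v hv).frequently)
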